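/- Let $U\subset\mathbb{C}$ be a bounded open set with diameter $\operatorname{diam}(U)$, let $k\ge 1$ be an integer, let $\alpha\in\mathbb{R}$ with $|\alpha|\ge 1$, and let $c\in\mathbb{C}$. Write $\partial=\frac12\left(\frac{\partial}{\partial x}-i\frac{\partial}{\partial y}\right)$ and $\bar\partial=\frac12\left(\frac{\partial}{\partial x}+i\frac{\partial}{\partial y}\right)$, and let $\sigma$ be Lebesgue measure on $\mathbb{C}$. Then for every $f\in L^2(U)$ there is a function $u\in L^2(U)$ that is a weak solution of $$\alpha\,\partial^k\bar\partial^k u+c\,u=\alpha f\quad\text{on }U,$$ that is, $$\alpha\int_U u\,\partial^k\bar\partial^k\phi\,d\sigma+c\int_U u\,\phi\,d\sigma=\alpha\int_U f\,\phi\,d\sigma$$ for every $C^\infty$ function $\phi:\mathbb{C}\to\mathbb{C}$ with compact support contained in $U$, and that satisfies $$\|u\|_{L^2(U)}^2\le\frac{e^{\operatorname{diam}(U)^2}\,|\alpha|^2}{(k!)^2}\,\|f\|_{L^2(U)}^2,\qquad\text{where } \|g\|_{L^2(U)}^2=\int_U|g|^2\,d\sigma.$$ -/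

import Mathlib

open MeasureTheory
open scoped ContDiff ENNReal

namespace Wirtinger

/-- The Wirtinger derivative `∂ = ∂/∂z = (∂/∂x - i ∂/∂y) / 2`. -/
noncomputable def dz (φ : ℂ → ℂ) (z : ℂ) : ℂ :=
  (fderiv ℝ φ z 1 - Complex.I * fderiv ℝ φ z Complex.I) / 2

/-- The Wirtinger derivative `∂̄ = ∂/∂z̄ = (∂/∂x + i ∂/∂y) / 2`. -/
noncomputable def dzbar (φ : ℂ → ℂ) (z : ℂ) : ℂ :=
  (fderiv ℝ φ z 1 + Complex.I * fderiv ℝ φ z Complex.I) / 2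

/-- `φ` is a complex-valued `C^∞` function whose support is a compact subset of `U`. -/
structure IsTestFunction (U : Set ℂ) (φ : ℂ → ℂ) : Prop where
  smooth : ContDiff ℝ ∞ φ
  compact : HasCompactSupport φ
  support_subset : tsupport φ ⊆ U

/-- `u` is a weak solution on `U` of `α ∂^k ∂̄^k u + c u = α f`: the equation holds after
integration against every test function, all the derivatives being moved to the test function
(the `2k` sign changes cancel). Meant for `u` and `f` locally square integrable on `U`. -/
def IsWeakSolution (U : Set ℂ) (k : ℕ) (α : ℝ) (c : ℂ) (f u : ℂ → ℂ) : Prop :=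
  ∀ φ : ℂ → ℂ, IsTestFunction U φ →
    (α : ℂ) * (∫ z in U, u z * (dz^[k] (dzbar^[k] φ)) z) + c * (∫ z in U, u z * φ z)
      = (α : ℂ) * ∫ z in U, f z * φ z

end Wirtinger

/-! This is Hörmander's weighted L² method with weight exp(-|z - z₀|²). Test functions are written
as the weight times ψ. Then ∂ and ∂̄ act on ψ, up to sign, as raising operators B₁, B₂, whose
weighted adjoints are A₁ = ∂̄ and A₂ = ∂. The only nonzero commutators among these are [Aᵢ, Bᵢ] = 1,
as for two independent harmonic oscillators.

Algebra alone then gives ‖A₂ᵏA₁ᵏψ‖² + (k!)²‖ψ‖² ≤ ‖B₁ᵏB₂ᵏψ‖²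
(`sq_norm_mul_lowering_pow_add_factorial_le`). Adding a scalar a to B₁ᵏB₂ᵏ and its conjugate to the
adjoint changes both squared norms equally (`sq_norm_add_smul_sub`), so k!‖ψ‖ ≤ ‖(B₁ᵏB₂ᵏ + a)ψ‖ for
every a.

Hahn–Banach and Riesz turn this estimate into a solution (`exists_inner_eq_inner_of_norm_le`).
Removing the weight, which lies between exp(-diam²) and 1 on U, costs the exponential factor. -/

/-! ### Abstract estimates for raising and lowering operators -/

section LadderOperators

variable {V H : Type*} [AddCommGroup V] [Module ℂ V] [NormedAddCommGroup H]
  [InnerProductSpace ℂ H]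

/-- `B` is a formal adjoint of `A` for the semi-inner product that `ι` pulls back to `V`. -/
def IsFormalAdjoint (ι : V →ₗ[ℂ] H) (A B : Module.End ℂ V) : Prop :=
  ∀ u v, inner ℂ (ι (A u)) (ι v) = inner ℂ (ι u) (ι (B v))

namespace IsFormalAdjoint

variable {ι : V →ₗ[ℂ] H} {A B A' B' : Module.End ℂ V}

theorem symm (h : IsFormalAdjoint ι A B) : IsFormalAdjoint ι B A := fun u v => by
  rw [← inner_conj_symm, ← h v u, inner_conj_symm]

theorem mul (h : IsFormalAdjoint ι A B) (h' : IsFormalAdjoint ι A' B') :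
    IsFormalAdjoint ι (A * A') (B' * B) := fun u v => by
  simp only [Module.End.mul_apply]
  rw [h, h']

theorem pow (h : IsFormalAdjoint ι A B) (k : ℕ) : IsFormalAdjoint ι (A ^ k) (B ^ k) := by
  induction k with
  | zero => intro u v; simp
  | succ k ih => rw [pow_succ, pow_succ']; exact ih.mul h

end IsFormalAdjoint

theorem lowering_mul_raising_pow {A B : Module.End ℂ V} (hc : A * B = B * A + 1) (k : ℕ) :
    A * B ^ (k + 1) = B ^ (k + 1) * A + (k + 1 : ℂ) • B ^ k := by
  induction k with
  | zero => simp [hc]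
  | succ k ih =>
    rw [pow_succ, ← mul_assoc, ih, add_mul, mul_assoc, hc, smul_mul_assoc, ← pow_succ]
    push_cast
    rw [mul_add, mul_one, ← mul_assoc, add_assoc, ← pow_succ, add_smul (k + 1 : ℂ) 1, one_smul,
      add_comm (B ^ (k + 1))]

variable {ι : V →ₗ[ℂ] H} {A B : Module.End ℂ V}

theorem inner_raising_pow_succ_lowering (h : IsFormalAdjoint ι A B) (j : ℕ) (v : V) :
    inner ℂ (ι ((B ^ (j + 1)) (A v))) (ι ((B ^ j) v)) =
      inner ℂ (ι ((B ^ j) (A v))) (ι ((A * B ^ j) v)) := by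
  rw [pow_succ', Module.End.mul_apply, h.symm, Module.End.mul_apply]

/-- Moving one B across and commuting A past Bʲ leaves the square on the left plus j times the same
inner product at level j - 1, which is nonnegative by induction. -/
theorem sq_norm_le_re_inner_raising_pow (h : IsFormalAdjoint ι A B) (hc : A * B = B * A + 1)
    (j : ℕ) (v : V) :
    ‖ι ((B ^ j) (A v))‖ ^ 2 ≤ (inner ℂ (ι ((B ^ (j + 1)) (A v))) (ι ((B ^ j) v))).re := by
  induction j with
  | zero =>
    rw [inner_raising_pow_succ_lowering h]
    simp only [pow_zero, mul_one, Module.End.one_apply]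
    exact (inner_self_eq_norm_sq (𝕜 := ℂ) (ι (A v))).ge
  | succ j ih =>
    rw [inner_raising_pow_succ_lowering h, lowering_mul_raising_pow hc, LinearMap.add_apply,
      map_add, inner_add_right, LinearMap.smul_apply, map_smul, inner_smul_right,
      Module.End.mul_apply, Complex.add_re]
    have h1 : (inner ℂ (ι ((B ^ (j + 1)) (A v))) (ι ((B ^ (j + 1)) (A v)))).re =
        ‖ι ((B ^ (j + 1)) (A v))‖ ^ 2 := inner_self_eq_norm_sq (𝕜 := ℂ) _
    have h2 : ((j : ℂ) + 1) = ((j + 1 : ℝ) : ℂ) := by push_cast; rfl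
    rw [h1, h2, Complex.re_ofReal_mul]
    have := mul_nonneg (show (0 : ℝ) ≤ j + 1 by positivity) ((sq_nonneg _).trans ih)
    linarith

/-- Writing ‖Bᵏ⁺¹v‖² as ⟨ABᵏ⁺¹v, Bᵏv⟩, the commutator yields the (k + 1) term and the previous lemma
bounds the remainder below. -/
theorem sq_norm_raising_pow_succ_ge (h : IsFormalAdjoint ι A B) (hc : A * B = B * A + 1)
    (k : ℕ) (v : V) :
    ‖ι ((B ^ k) (A v))‖ ^ 2 + (k + 1) * ‖ι ((B ^ k) v)‖ ^ 2 ≤ ‖ι ((B ^ (k + 1)) v)‖ ^ 2 := by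
  have h1 : ‖ι ((B ^ (k + 1)) v)‖ ^ 2 =
      (inner ℂ (ι ((A * B ^ (k + 1)) v)) (ι ((B ^ k) v))).re := by
    rw [Module.End.mul_apply, h, ← Module.End.mul_apply B, ← pow_succ']
    exact (inner_self_eq_norm_sq (𝕜 := ℂ) _).symm
  have h2 : (inner ℂ (ι ((B ^ k) v)) (ι ((B ^ k) v))).re = ‖ι ((B ^ k) v)‖ ^ 2 :=
    inner_self_eq_norm_sq (𝕜 := ℂ) _
  have h3 : ((k : ℂ) + 1) = ((k + 1 : ℝ) : ℂ) := by push_cast; rfl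
  rw [h1, lowering_mul_raising_pow hc, LinearMap.add_apply, map_add, inner_add_left,
    LinearMap.smul_apply, map_smul, inner_smul_left, Module.End.mul_apply, Complex.add_re, h3,
    Complex.conj_ofReal, Complex.re_ofReal_mul, h2]
  linarith [sq_norm_le_re_inner_raising_pow h hc k v]

theorem sq_norm_lowering_pow_le (h : IsFormalAdjoint ι A B) (hc : A * B = B * A + 1)
    (k : ℕ) (v : V) : ‖ι ((A ^ k) v)‖ ^ 2 ≤ ‖ι ((B ^ k) v)‖ ^ 2 := by
  induction k generalizing v with
  | zero => simp
  | succ k ih =>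
    have h1 := sq_norm_raising_pow_succ_ge h hc k v
    have h2 := ih (A v)
    rw [pow_succ A, Module.End.mul_apply]
    have : 0 ≤ (k + 1 : ℝ) * ‖ι ((B ^ k) v)‖ ^ 2 := by positivity
    linarith

theorem factorial_mul_sq_norm_le (h : IsFormalAdjoint ι A B) (hc : A * B = B * A + 1)
    (k : ℕ) (v : V) : (k.factorial : ℝ) * ‖ι v‖ ^ 2 ≤ ‖ι ((B ^ k) v)‖ ^ 2 := by
  induction k with
  | zero => simp
  | succ k ih =>
    have h1 := sq_norm_raising_pow_succ_ge h hc k v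
    have h2 := mul_le_mul_of_nonneg_left ih (show (0 : ℝ) ≤ k + 1 by positivity)
    have := sq_nonneg ‖ι ((B ^ k) (A v))‖
    rw [Nat.factorial_succ]
    push_cast
    linarith

theorem sq_norm_lowering_pow_add_factorial_le (h : IsFormalAdjoint ι A B)
    (hc : A * B = B * A + 1) {k : ℕ} (hk : 1 ≤ k) (v : V) :
    ‖ι ((A ^ k) v)‖ ^ 2 + k.factorial * ‖ι v‖ ^ 2 ≤ ‖ι ((B ^ k) v)‖ ^ 2 := by
  obtain ⟨k, rfl⟩ := Nat.exists_eq_succ_of_ne_zero (Nat.one_le_iff_ne_zero.1 hk)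
  have h1 := sq_norm_raising_pow_succ_ge h hc k v
  have h2 := sq_norm_lowering_pow_le h hc k (A v)
  have h3 := mul_le_mul_of_nonneg_left (factorial_mul_sq_norm_le h hc k v)
    (show (0 : ℝ) ≤ k + 1 by positivity)
  rw [← Module.End.mul_apply, ← pow_succ] at h2
  rw [Nat.succ_eq_add_one, Nat.factorial_succ]
  push_cast
  linarith

/-- The one-pair estimate for (A₁, B₁) is applied to B₂ᵏv. Since A₁ᵏ commutes with B₂ᵏ, both
resulting terms have the form B₂ᵏw and are bounded below using the second pair. The case k = 0 would
fail, giving 2‖v‖² ≤ ‖v‖². -/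
theorem sq_norm_mul_lowering_pow_add_factorial_le {A₁ B₁ A₂ B₂ : Module.End ℂ V}
    (h₁ : IsFormalAdjoint ι A₁ B₁) (hc₁ : A₁ * B₁ = B₁ * A₁ + 1)
    (h₂ : IsFormalAdjoint ι A₂ B₂) (hc₂ : A₂ * B₂ = B₂ * A₂ + 1)
    (hc : Commute A₁ B₂) {k : ℕ} (hk : 1 ≤ k) (v : V) :
    ‖ι ((A₂ ^ k * A₁ ^ k) v)‖ ^ 2 + (k.factorial : ℝ) ^ 2 * ‖ι v‖ ^ 2 ≤
      ‖ι ((B₁ ^ k * B₂ ^ k) v)‖ ^ 2 := by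
  have e1 := sq_norm_lowering_pow_add_factorial_le h₁ hc₁ hk ((B₂ ^ k) v)
  have e2 := sq_norm_lowering_pow_le h₂ hc₂ k ((A₁ ^ k) v)
  have e3 := mul_le_mul_of_nonneg_left (factorial_mul_sq_norm_le h₂ hc₂ k v)
    (show (0 : ℝ) ≤ k.factorial by positivity)
  rw [← Module.End.mul_apply (A₁ ^ k), (hc.pow_pow k k).eq] at e1
  simp only [Module.End.mul_apply] at *
  linarith

/-- The cross terms ⟨D'v, av⟩ and ⟨Dv, āv⟩ are complex conjugates, so their real parts cancel. -/
theorem sq_norm_add_smul_sub {D D' : Module.End ℂ V} (h : IsFormalAdjoint ι D D') (a : ℂ) (v : V) :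
    ‖ι ((D' + a • 1) v)‖ ^ 2 - ‖ι ((D + star a • 1) v)‖ ^ 2 = ‖ι (D' v)‖ ^ 2 - ‖ι (D v)‖ ^ 2 := by
  simp only [LinearMap.add_apply, LinearMap.smul_apply, Module.End.one_apply, map_add, map_smul]
  rw [norm_add_sq (𝕜 := ℂ), norm_add_sq (𝕜 := ℂ), norm_smul, norm_smul, norm_star,
    inner_smul_right, inner_smul_right, h.symm, ← inner_conj_symm (ι v)]
  simp only [RCLike.re_to_complex, Complex.mul_re, Complex.conj_re, Complex.conj_im,
    Complex.star_def]
  ring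

theorem factorial_mul_norm_le_norm_raising_add_smul {A₁ B₁ A₂ B₂ : Module.End ℂ V}
    (h₁ : IsFormalAdjoint ι A₁ B₁) (hc₁ : A₁ * B₁ = B₁ * A₁ + 1)
    (h₂ : IsFormalAdjoint ι A₂ B₂) (hc₂ : A₂ * B₂ = B₂ * A₂ + 1)
    (hc : Commute A₁ B₂) {k : ℕ} (hk : 1 ≤ k) (a : ℂ) (v : V) :
    k.factorial * ‖ι v‖ ≤ ‖ι ((B₁ ^ k * B₂ ^ k + a • 1) v)‖ := by
  have e1 := sq_norm_mul_lowering_pow_add_factorial_le h₁ hc₁ h₂ hc₂ hc hk v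
  have e2 := sq_norm_add_smul_sub ((h₂.pow k).mul (h₁.pow k)) a v
  refine le_of_sq_le_sq ?_ (norm_nonneg _)
  have := sq_nonneg ‖ι ((A₂ ^ k * A₁ ^ k + star a • 1) v)‖
  rw [mul_pow]
  linarith

/-! ### Duality: from an a priori estimate to existence -/

/-- If `‖S v‖ ≤ C ‖T v‖` for all `v`, then `T† h = S† F` has a solution with `‖h‖ ≤ C ‖F‖`. -/
theorem exists_inner_eq_inner_of_norm_le [CompleteSpace H] (S T : V →ₗ[ℂ] H) {C : ℝ} (hC : 0 ≤ C)
    (hST : ∀ v, ‖S v‖ ≤ C * ‖T v‖) (F : H) :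
    ∃ h : H, (∀ v, inner ℂ h (T v) = inner ℂ F (S v)) ∧ ‖h‖ ≤ C * ‖F‖ := by
  let g : V →ₗ[ℂ] ℂ := (innerSL ℂ F).toLinearMap ∘ₗ S
  have hg : ∀ v, ‖g v‖ ≤ C * ‖F‖ * ‖T v‖ := fun v =>
    calc ‖g v‖ ≤ ‖F‖ * ‖S v‖ := norm_inner_le_norm _ _
      _ ≤ ‖F‖ * (C * ‖T v‖) := by gcongr; exact hST v
      _ = C * ‖F‖ * ‖T v‖ := by ring
  -- The functional Tv ↦ ⟨F, Sv⟩ is well defined on the range of T, because the bound forces it to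
  -- vanish where Tv = 0.
  have happly (v : V) : g.compLeftInverse T ⟨T v, v, rfl⟩ = g v :=
    LinearMap.compLeftInverse_apply_of_bdd g T ⟨_, hg⟩ v _ rfl
  obtain ⟨G, hG, hGn⟩ := exists_extension_norm_eq (LinearMap.range T) (g.compLeftInverse T)
  refine ⟨(InnerProductSpace.toDual ℂ H).symm G, fun v => ?_, ?_⟩
  · rw [InnerProductSpace.toDual_symm_apply]
    exact (hG ⟨T v, v, rfl⟩).trans (happly v)
  · rw [LinearIsometryEquiv.norm_map, hGn]
    refine ContinuousLinearMap.opNorm_le_bound _ (by positivity) ?_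
    rintro ⟨_, v, rfl⟩
    rw [happly]
    exact hg v

end LadderOperators

/-! ### Calculus of the Wirtinger derivatives -/

namespace Wirtinger

/-- The operator `(∂/∂x + s ∂/∂y) / 2`, which is `∂` for `s = -i` and `∂̄` for `s = i`. -/
noncomputable def wirtingerDeriv (s : ℂ) (φ : ℂ → ℂ) (z : ℂ) : ℂ :=
  (fderiv ℝ φ z 1 + s * fderiv ℝ φ z Complex.I) / 2

theorem dz_eq_wirtingerDeriv : dz = wirtingerDeriv (-Complex.I) := by
  funext φ z
  simp [dz, wirtingerDeriv, sub_eq_add_neg]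

theorem dzbar_eq_wirtingerDeriv : dzbar = wirtingerDeriv Complex.I := rfl

section Calculus

variable {f g : ℂ → ℂ} (s t : ℂ)

theorem _root_.HasFDerivAt.wirtingerDeriv_eq {f' : ℂ →L[ℝ] ℂ} {z : ℂ} (h : HasFDerivAt f f' z) :
    wirtingerDeriv s f z = (f' 1 + s * f' Complex.I) / 2 := by
  rw [wirtingerDeriv, h.fderiv]

theorem wirtingerDeriv_add {z : ℂ} (hf : DifferentiableAt ℝ f z) (hg : DifferentiableAt ℝ g z) :
    wirtingerDeriv s (f + g) z = wirtingerDeriv s f z + wirtingerDeriv s g z := by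
  rw [(hf.hasFDerivAt.add hg.hasFDerivAt).wirtingerDeriv_eq, wirtingerDeriv, wirtingerDeriv]
  simp only [add_apply]
  ring

theorem wirtingerDeriv_mul {z : ℂ} (hf : DifferentiableAt ℝ f z) (hg : DifferentiableAt ℝ g z) :
    wirtingerDeriv s (f * g) z = f z * wirtingerDeriv s g z + wirtingerDeriv s f z * g z := by
  rw [(hf.hasFDerivAt.mul hg.hasFDerivAt).wirtingerDeriv_eq, wirtingerDeriv, wirtingerDeriv]
  simp only [add_apply, smul_apply, smul_eq_mul]
  ring

theorem wirtingerDeriv_const_smul (a : ℂ) {z : ℂ} (hf : DifferentiableAt ℝ f z) :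
    wirtingerDeriv s (a • f) z = a * wirtingerDeriv s f z := by
  rw [(hf.hasFDerivAt.const_smul a).wirtingerDeriv_eq, wirtingerDeriv]
  simp only [smul_apply, smul_eq_mul]
  ring

theorem wirtingerDeriv_star {z : ℂ} (hf : DifferentiableAt ℝ f z) :
    wirtingerDeriv s (star f) z = star (wirtingerDeriv (star s) f z) := by
  have h : HasFDerivAt (star f) _ z := Complex.conjCLE.hasFDerivAt.comp z hf.hasFDerivAt
  rw [h.wirtingerDeriv_eq, wirtingerDeriv]
  simp

theorem contDiff_wirtingerDeriv (hf : ContDiff ℝ ∞ f) : ContDiff ℝ ∞ (wirtingerDeriv s f) := by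
  have h : ContDiff ℝ ∞ (fderiv ℝ f) := hf.fderiv_right (by simp)
  unfold wirtingerDeriv
  fun_prop

theorem tsupport_wirtingerDeriv_subset : tsupport (wirtingerDeriv s f) ⊆ tsupport f := by
  refine (closure_mono fun z hz => ?_).trans (tsupport_fderiv_subset ℝ)
  contrapose! hz
  simp only [Function.mem_support, not_not] at hz ⊢
  simp [wirtingerDeriv, hz]

theorem wirtingerDeriv_comm (hf : ContDiff ℝ ∞ f) :
    wirtingerDeriv s (wirtingerDeriv t f) = wirtingerDeriv t (wirtingerDeriv s f) := by
  funext z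
  have h : ContDiff ℝ ∞ (fderiv ℝ f) := hf.fderiv_right (by simp)
  have hz : HasFDerivAt (fderiv ℝ f) (fderiv ℝ (fderiv ℝ f) z) z :=
    (h.differentiable (by simp) z).hasFDerivAt
  have key (r : ℂ) : HasFDerivAt (wirtingerDeriv r f) _ z :=
    ((hz.clm_apply (hasFDerivAt_const (1 : ℂ) z)).add
      ((hz.clm_apply (hasFDerivAt_const Complex.I z)).const_mul r)).mul_const (2⁻¹ : ℂ)
  -- Commutation reduces to symmetry of the mixed second derivative in the directions 1 and i.
  have hsymm : IsSymmSndFDerivAt ℝ f z := 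
    hf.contDiffAt.isSymmSndFDerivAt
      (by rw [minSmoothness_of_isRCLikeNormedField]; 
          exact WithTop.coe_le_coe.2 (le_top : (2 : ℕ∞) ≤ ⊤))
  rw [(key t).wirtingerDeriv_eq, (key s).wirtingerDeriv_eq]
  simp [hsymm 1 Complex.I]
  ring

theorem integral_mul_wirtingerDeriv (hf : ContDiff ℝ ∞ f) (hg : ContDiff ℝ ∞ g)
    (hgc : HasCompactSupport g) :
    ∫ z, f z * wirtingerDeriv s g z = - ∫ z, wirtingerDeriv s f z * g z := by
  have hf' : ContDiff ℝ ∞ (fderiv ℝ f) := hf.fderiv_right (by simp)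
  have hg' : ContDiff ℝ ∞ (fderiv ℝ g) := hg.fderiv_right (by simp)
  have hgc' (v : ℂ) : HasCompactSupport fun z => fderiv ℝ g z v := hgc.fderiv_apply ℝ v
  have i1 (v : ℂ) : Integrable fun z => fderiv ℝ f z v * g z :=
    (by fun_prop : Continuous fun z => fderiv ℝ f z v * g z).integrable_of_hasCompactSupport
      hgc.mul_left
  have i2 (v : ℂ) : Integrable fun z => f z * fderiv ℝ g z v :=
    (by fun_prop : Continuous fun z => f z * fderiv ℝ g z v).integrable_of_hasCompactSupport
      (hgc' v).mul_left
  have i3 : Integrable fun z => f z * g z :=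
    (by fun_prop : Continuous fun z => f z * g z).integrable_of_hasCompactSupport hgc.mul_left
  have key (v : ℂ) := integral_mul_fderiv_eq_neg_fderiv_mul_of_integrable (i1 v) (i2 v) i3
    (fun z _ => hf.differentiable (by simp) z) (fun z _ => hg.differentiable (by simp) z)
  have e1 : (fun z => f z * wirtingerDeriv s g z) = fun z =>
      2⁻¹ * (f z * fderiv ℝ g z 1) + s / 2 * (f z * fderiv ℝ g z Complex.I) := by
    funext z; rw [wirtingerDeriv]; ring
  have e2 : (fun z => wirtingerDeriv s f z * g z) = fun z =>
      2⁻¹ * (fderiv ℝ f z 1 * g z) + s / 2 * (fderiv ℝ f z Complex.I * g z) := by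
    funext z; rw [wirtingerDeriv]; ring
  rw [e1, e2, integral_add ((i2 1).const_mul _) ((i2 Complex.I).const_mul _),
    integral_add ((i1 1).const_mul _) ((i1 Complex.I).const_mul _)]
  simp only [integral_const_mul, key]
  ring

end Calculus

/-! ### The Gaussian weight -/

section Weight

variable (z₀ : ℂ)

/-- The real-linear form `x + t y` in `z - z₀ = x + i y`; it is `(∂/∂x + t ∂/∂y) / 2` applied to
`|z - z₀|²`. -/
noncomputable def gaussianForm (t z : ℂ) : ℂ := ((z - z₀).re : ℂ) + t * ((z - z₀).im : ℂ)

/-- The square root `exp (-|z - z₀|² / 2)` of the Gaussian weight. -/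
noncomputable def sqrtGaussian (z : ℂ) : ℝ := Real.exp (-(‖z - z₀‖ ^ 2 / 2))

/-- The Gaussian weight `exp (-|z - z₀|²)`, as a complex-valued function. -/
noncomputable def gaussian (z : ℂ) : ℂ := (Real.exp (-‖z - z₀‖ ^ 2) : ℂ)

theorem hasFDerivAt_gaussianForm (t z : ℂ) :
    HasFDerivAt (gaussianForm z₀ t)
      (Complex.ofRealCLM ∘L Complex.reCLM + t • (Complex.ofRealCLM ∘L Complex.imCLM)) z := by
  have h : HasFDerivAt (fun z : ℂ => z - z₀) (ContinuousLinearMap.id ℝ ℂ) z :=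
    (hasFDerivAt_id z).sub_const z₀
  exact ((Complex.ofRealCLM ∘L Complex.reCLM).hasFDerivAt.comp z h).add
    (((Complex.ofRealCLM ∘L Complex.imCLM).hasFDerivAt.comp z h).const_mul t)

theorem contDiff_gaussianForm (t : ℂ) : ContDiff ℝ ∞ (gaussianForm z₀ t) := by
  have h : ContDiff ℝ ∞ (fun z : ℂ => z - z₀) := by fun_prop
  exact ((Complex.ofRealCLM ∘L Complex.reCLM).contDiff.comp h).add
    (contDiff_const.mul ((Complex.ofRealCLM ∘L Complex.imCLM).contDiff.comp h))

theorem wirtingerDeriv_gaussianForm (s t z : ℂ) :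
    wirtingerDeriv s (gaussianForm z₀ t) z = (1 + s * t) / 2 := by
  rw [(hasFDerivAt_gaussianForm z₀ t z).wirtingerDeriv_eq]
  simp

theorem sqrtGaussian_mul_self (z : ℂ) :
    (sqrtGaussian z₀ z : ℂ) * sqrtGaussian z₀ z = gaussian z₀ z := by
  rw [sqrtGaussian, gaussian, ← Complex.ofReal_mul, ← Real.exp_add]
  ring_nf

theorem contDiff_ofReal_sqrtGaussian : ContDiff ℝ ∞ fun z => (sqrtGaussian z₀ z : ℂ) := by
  have h : ContDiff ℝ ∞ fun z : ℂ => ‖z - z₀‖ ^ 2 :=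
    (by fun_prop : ContDiff ℝ ∞ fun z : ℂ => z - z₀).norm_sq ℝ
  exact Complex.ofRealCLM.contDiff.comp (h.div_const 2).neg.exp

theorem contDiff_gaussian : ContDiff ℝ ∞ (gaussian z₀) := by
  have h : ContDiff ℝ ∞ fun z : ℂ => ‖z - z₀‖ ^ 2 :=
    (by fun_prop : ContDiff ℝ ∞ fun z : ℂ => z - z₀).norm_sq ℝ
  exact Complex.ofRealCLM.contDiff.comp h.neg.exp

theorem gaussian_ne_zero (z : ℂ) : gaussian z₀ z ≠ 0 :=
  Complex.ofReal_ne_zero.2 (Real.exp_pos _).ne'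

theorem wirtingerDeriv_gaussian (s z : ℂ) :
    wirtingerDeriv s (gaussian z₀) z = -(gaussianForm z₀ s z * gaussian z₀ z) := by
  have h : HasFDerivAt (fun z : ℂ => z - z₀) (ContinuousLinearMap.id ℝ ℂ) z :=
    (hasFDerivAt_id z).sub_const z₀
  have h' : HasFDerivAt (gaussian z₀) _ z :=
    Complex.ofRealCLM.hasFDerivAt.comp z (h.norm_sq.neg.exp)
  rw [h'.wirtingerDeriv_eq, gaussianForm, gaussian]
  simp [Complex.inner]
  ring

end Weight

end Wirtinger

/-! ### Ladder operators on test functions -/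

namespace Wirtinger

/-- The space of test functions on `U`. -/
def testSpace (U : Set ℂ) : Submodule ℂ (ℂ → ℂ) where
  carrier := {φ | IsTestFunction U φ}
  zero_mem' := ⟨contDiff_const, HasCompactSupport.zero, by simp [tsupport]⟩
  add_mem' {φ ψ} hφ hψ :=
    ⟨hφ.smooth.add hψ.smooth, hφ.compact.add hψ.compact,
      (tsupport_add φ ψ).trans (Set.union_subset hφ.support_subset hψ.support_subset)⟩
  smul_mem' a φ hφ :=
    ⟨contDiff_const.smul hφ.smooth, hφ.compact.smul_left (f := fun _ => a),
      (tsupport_smul_subset_right (fun _ => a) φ).trans hφ.support_subset⟩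

variable {U : Set ℂ}

theorem IsTestFunction.wirtingerDeriv {φ : ℂ → ℂ} (h : IsTestFunction U φ) (s : ℂ) :
    IsTestFunction U (wirtingerDeriv s φ) :=
  ⟨contDiff_wirtingerDeriv s h.smooth,
    h.compact.mono' ((subset_tsupport _).trans (tsupport_wirtingerDeriv_subset s)),
    (tsupport_wirtingerDeriv_subset s).trans h.support_subset⟩

theorem IsTestFunction.mul_left {g φ : ℂ → ℂ} (h : IsTestFunction U φ) (hg : ContDiff ℝ ∞ g) :
    IsTestFunction U (g * φ) :=
  ⟨hg.mul h.smooth, h.compact.mul_left, tsupport_mul_subset_right.trans h.support_subset⟩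

theorem IsTestFunction.differentiableAt {φ : ℂ → ℂ} (h : IsTestFunction U φ) (z : ℂ) :
    DifferentiableAt ℝ φ z :=
  h.smooth.differentiable (by simp) z

/-- `(∂/∂x + s ∂/∂y) / 2` as an operator on test functions. -/
noncomputable def wirtingerEnd (U : Set ℂ) (s : ℂ) : Module.End ℂ (testSpace U) where
  toFun φ := ⟨wirtingerDeriv s φ, φ.2.wirtingerDeriv s⟩
  map_add' φ ψ := Subtype.ext <| funext fun z =>
    wirtingerDeriv_add s (φ.2.differentiableAt z) (ψ.2.differentiableAt z)
  map_smul' a φ := Subtype.ext <| funext fun z =>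
    wirtingerDeriv_const_smul s a (φ.2.differentiableAt z)

/-- Multiplication by a smooth function as an operator on test functions. -/
noncomputable def mulEnd (U : Set ℂ) (g : ℂ → ℂ) (hg : ContDiff ℝ ∞ g) :
    Module.End ℂ (testSpace U) where
  toFun φ := ⟨g * φ, φ.2.mul_left hg⟩
  map_add' φ ψ := Subtype.ext (mul_add g φ ψ)
  map_smul' a φ := Subtype.ext (mul_smul_comm a g φ)

/-- The raising operator `φ ↦ -e^{|z - z₀|²} D (e^{-|z - z₀|²} φ)`, where
`D = (∂/∂x + t ∂/∂y) / 2`. -/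
noncomputable def raisingEnd (U : Set ℂ) (z₀ t : ℂ) : Module.End ℂ (testSpace U) :=
  mulEnd U (gaussianForm z₀ t) (contDiff_gaussianForm z₀ t) - wirtingerEnd U t

/-- Derivatives commute, so only the derivative of the linear form contributes. The scalar is 1 for
{s, t} = {i, -i} and 0 for s = t = ±i. -/
theorem wirtingerEnd_mul_raisingEnd (z₀ s t : ℂ) :
    wirtingerEnd U s * raisingEnd U z₀ t =
      raisingEnd U z₀ t * wirtingerEnd U s + ((1 + s * t) / 2) • 1 := by
  refine LinearMap.ext fun φ => ?_
  have h1 : wirtingerEnd U s (wirtingerEnd U t φ) = wirtingerEnd U t (wirtingerEnd U s φ) :=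
    Subtype.ext (wirtingerDeriv_comm s t φ.2.smooth)
  have h2 : wirtingerEnd U s (mulEnd U (gaussianForm z₀ t) (contDiff_gaussianForm z₀ t) φ) =
      mulEnd U (gaussianForm z₀ t) (contDiff_gaussianForm z₀ t) (wirtingerEnd U s φ) +
        ((1 + s * t) / 2) • φ := by
    refine Subtype.ext (funext fun z => ?_)
    have := wirtingerDeriv_mul s (hasFDerivAt_gaussianForm z₀ t z).differentiableAt
      (φ.2.differentiableAt z)
    rwa [wirtingerDeriv_gaussianForm] at this
  simp only [raisingEnd, Module.End.mul_apply, LinearMap.sub_apply, LinearMap.add_apply,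
    LinearMap.smul_apply, Module.End.one_apply, map_sub, h1, h2]
  abel

theorem wirtingerDeriv_gaussian_mul (z₀ t : ℂ) (φ : testSpace U) :
    wirtingerDeriv t (gaussian z₀ * φ) = gaussian z₀ * (((-1 : ℂ) • raisingEnd U z₀ t) φ : testSpace U) := by
  funext z
  rw [wirtingerDeriv_mul t ((contDiff_gaussian z₀).differentiable (by simp) z)
    (φ.2.differentiableAt z), wirtingerDeriv_gaussian]
  have h : (((-1 : ℂ) • raisingEnd U z₀ t) φ : testSpace U).1 z =
      -1 * (gaussianForm z₀ t z * φ.1 z - wirtingerDeriv t φ.1 z) := rfl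
  rw [Pi.mul_apply, h]
  ring

theorem wirtingerDeriv_iterate_gaussian_mul (z₀ t : ℂ) (k : ℕ) (φ : testSpace U) :
    (wirtingerDeriv t)^[k] (gaussian z₀ * φ) =
      gaussian z₀ * ((((-1 : ℂ) • raisingEnd U z₀ t) ^ k) φ : testSpace U) := by
  induction k generalizing φ with
  | zero => rfl
  | succ k ih =>
    rw [Function.iterate_succ_apply, wirtingerDeriv_gaussian_mul, ih, pow_succ,
      Module.End.mul_apply]

theorem dz_iterate_dzbar_iterate_gaussian_mul (z₀ : ℂ) (k : ℕ) (φ : testSpace U) :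
    dz^[k] (dzbar^[k] (gaussian z₀ * φ)) = gaussian z₀ *
      ((raisingEnd U z₀ (-Complex.I) ^ k * raisingEnd U z₀ Complex.I ^ k) φ : testSpace U) := by
  rw [dz_eq_wirtingerDeriv, dzbar_eq_wirtingerDeriv, wirtingerDeriv_iterate_gaussian_mul,
    wirtingerDeriv_iterate_gaussian_mul, ← Module.End.mul_apply]
  -- The 2k signs from the raising operators cancel.
  rw [smul_pow, smul_pow, smul_mul_smul_comm, ← mul_pow, neg_one_mul, neg_neg, one_pow, one_smul]

/-- The weight is smooth and never zero, so testing against weighted test functions loses nothing.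
-/
theorem exists_eq_gaussian_mul (z₀ : ℂ) {φ : ℂ → ℂ} (hφ : IsTestFunction U φ) :
    ∃ ψ : testSpace U, φ = gaussian z₀ * ψ := by
  refine ⟨⟨(gaussian z₀)⁻¹ * φ, hφ.mul_left ?_⟩, ?_⟩
  · exact (contDiff_gaussian z₀).inv (gaussian_ne_zero z₀)
  · funext z
    simp [gaussian_ne_zero]

/-! ### The weighted inner product and adjointness -/

section Embedding

theorem IsTestFunction.memLp {φ : ℂ → ℂ} (h : IsTestFunction U φ) :
    MemLp φ 2 (volume.restrict U) :=
  (h.smooth.continuous.memLp_of_hasCompactSupport h.compact).restrict U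

theorem memLp_sqrtGaussian_mul (z₀ : ℂ) (φ : testSpace U) :
    MemLp (fun z => (sqrtGaussian z₀ z : ℂ) * (φ : ℂ → ℂ) z) 2 (volume.restrict U) :=
  (φ.2.mul_left (contDiff_ofReal_sqrtGaussian z₀)).memLp

/-- A test function `φ` gives the square integrable function `e^{-|z - z₀|² / 2} φ`. -/
noncomputable def toWeightedL2 (U : Set ℂ) (z₀ : ℂ) :
    testSpace U →ₗ[ℂ] Lp ℂ 2 (volume.restrict U) where
  toFun φ := (memLp_sqrtGaussian_mul z₀ φ).toLp _
  map_add' φ ψ := by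
    rw [← MemLp.toLp_add (memLp_sqrtGaussian_mul z₀ φ) (memLp_sqrtGaussian_mul z₀ ψ)]
    congr 1
    funext z
    exact mul_add _ _ _
  map_smul' a φ := by
    rw [RingHom.id_apply, ← MemLp.toLp_const_smul a (memLp_sqrtGaussian_mul z₀ φ)]
    congr 1
    funext z
    exact mul_left_comm _ _ _

theorem coeFn_toWeightedL2 (z₀ : ℂ) (φ : testSpace U) :
    toWeightedL2 U z₀ φ =ᵐ[volume.restrict U] fun z => sqrtGaussian z₀ z * (φ : ℂ → ℂ) z :=
  (memLp_sqrtGaussian_mul z₀ φ).coeFn_toLp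

/-- Since ψ is supported in U, the inner product is an integral over the whole plane, where
integration by parts has no boundary term. -/
theorem inner_toWeightedL2 (z₀ : ℂ) (φ ψ : testSpace U) :
    inner ℂ (toWeightedL2 U z₀ φ) (toWeightedL2 U z₀ ψ) =
      ∫ z, star (φ : ℂ → ℂ) z * (gaussian z₀ * ψ) z := by
  rw [L2.inner_def, ← setIntegral_eq_integral_of_forall_compl_eq_zero (s := U) (μ := volume)
    (f := fun z => star (φ : ℂ → ℂ) z * (gaussian z₀ * ψ) z)]
  · refine integral_congr_ae ?_
    filter_upwards [coeFn_toWeightedL2 z₀ φ, coeFn_toWeightedL2 z₀ ψ] with z h1 h2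
    rw [h1, h2, Pi.mul_apply, ← sqrtGaussian_mul_self]
    simp only [RCLike.inner_apply, map_mul, Complex.conj_ofReal, Pi.star_apply, Complex.star_def]
    ring
  · intro z hz
    have : (ψ : ℂ → ℂ) z = 0 := image_eq_zero_of_notMem_tsupport fun h =>
      hz (ψ.2.support_subset h)
    simp [this]

theorem isFormalAdjoint_wirtingerEnd_raisingEnd (z₀ s : ℂ) :
    IsFormalAdjoint (toWeightedL2 U z₀) (wirtingerEnd U s) (raisingEnd U z₀ (star s)) := by
  intro φ ψ
  have hφ : ContDiff ℝ ∞ (star (φ : ℂ → ℂ)) := Complex.conjCLE.contDiff.comp φ.2.smooth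
  have hψ := ψ.2.mul_left (contDiff_gaussian z₀)
  have h := integral_mul_wirtingerDeriv (star s) hφ hψ.smooth hψ.compact
  rw [wirtingerDeriv_gaussian_mul] at h
  rw [inner_toWeightedL2, inner_toWeightedL2]
  have e1 (z : ℂ) : wirtingerDeriv (star s) (star (φ : ℂ → ℂ)) z =
      star ((wirtingerEnd U s φ : testSpace U) : ℂ → ℂ) z := by
    rw [wirtingerDeriv_star _ (φ.2.differentiableAt z), star_star]
    rfl
  simp only [e1] at h
  rw [← neg_eq_iff_eq_neg] at h
  rw [← h, ← integral_neg]
  congr 1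
  funext z
  simp

end Embedding

/-! ### A priori estimate and weak solutions -/

/-- The weighted a priori estimate for `∂^k ∂̄^k + a`. -/
theorem factorial_mul_norm_toWeightedL2_le (z₀ : ℂ) {k : ℕ} (hk : 1 ≤ k) (a : ℂ)
    (φ : testSpace U) :
    k.factorial * ‖toWeightedL2 U z₀ φ‖ ≤ ‖toWeightedL2 U z₀
      ((raisingEnd U z₀ (-Complex.I) ^ k * raisingEnd U z₀ Complex.I ^ k + a • 1) φ)‖ := by
  have h₁ := isFormalAdjoint_wirtingerEnd_raisingEnd (U := U) z₀ Complex.I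
  have h₂ := isFormalAdjoint_wirtingerEnd_raisingEnd (U := U) z₀ (-Complex.I)
  rw [show star Complex.I = -Complex.I from Complex.conj_I] at h₁
  rw [star_neg, show star Complex.I = -Complex.I from Complex.conj_I, neg_neg] at h₂
  -- Here A₁ = ∂̄ is paired with the raising operator of ∂, and A₂ = ∂ with that of ∂̄.
  refine factorial_mul_norm_le_norm_raising_add_smul h₁ ?_ h₂ ?_ ?_ hk a φ
  · simp [wirtingerEnd_mul_raisingEnd]
  · simp [wirtingerEnd_mul_raisingEnd]
  · simp [Commute, SemiconjBy, wirtingerEnd_mul_raisingEnd]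

/-- Conjugating an `L²` function and multiplying it by a real function bounded by `C` on `U`. -/
theorem exists_Lp_ae_eq_star_mul (hU : MeasurableSet U) {g : ℂ → ℝ} (hg : Continuous g) {C : ℝ}
    (hC : ∀ z ∈ U, |g z| ≤ C) (f : Lp ℂ 2 (volume.restrict U)) :
    ∃ F : Lp ℂ 2 (volume.restrict U),
      F =ᵐ[volume.restrict U] (fun z => star (f z) * (g z : ℂ)) ∧ ‖F‖ ≤ C * ‖f‖ := by
  have hbound : ∀ᵐ z ∂volume.restrict U, ‖star (f z) * (g z : ℂ)‖ ≤ C * ‖f z‖ := by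
    filter_upwards [ae_restrict_mem hU] with z hz
    rw [norm_mul, norm_star, Complex.norm_real, Real.norm_eq_abs, mul_comm]
    exact mul_le_mul_of_nonneg_right (hC z hz) (norm_nonneg _)
  have hmem : MemLp (fun z => star (f z) * (g z : ℂ)) 2 (volume.restrict U) :=
    (Lp.memLp f).of_le_mul ((Lp.aestronglyMeasurable f).star.mul
      (Complex.continuous_ofReal.comp hg).aestronglyMeasurable) hbound
  refine ⟨hmem.toLp _, hmem.coeFn_toLp, Lp.norm_le_mul_norm_of_ae_le_mul ?_⟩
  filter_upwards [hmem.coeFn_toLp, hbound] with z h1 h2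
  rwa [h1]

theorem continuous_sqrtGaussian (z₀ : ℂ) : Continuous (sqrtGaussian z₀) := by
  unfold sqrtGaussian
  fun_prop

/-- The equation `∂^k ∂̄^k u + a u = f` has a weak solution on `U` with the `L²` bound. -/
theorem exists_weak_solution (hU : MeasurableSet U) {z₀ : ℂ} {d : ℝ} (hd : ∀ z ∈ U, ‖z - z₀‖ ≤ d)
    {k : ℕ} (hk : 1 ≤ k) (a : ℂ) (f : Lp ℂ 2 (volume.restrict U)) :
    ∃ u : Lp ℂ 2 (volume.restrict U),
      (∀ φ, IsTestFunction U φ → (∫ z in U, u z * (dz^[k] (dzbar^[k] φ)) z) +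
        a * (∫ z in U, u z * φ z) = ∫ z in U, f z * φ z) ∧
      ‖u‖ ≤ Real.exp (d ^ 2 / 2) * ((k.factorial : ℝ)⁻¹ * ‖f‖) := by
  have hpos (z : ℂ) : 0 < sqrtGaussian z₀ z := Real.exp_pos _
  -- The inner product conjugates its first argument. So F is the conjugate of f times the root of
  -- the weight, and u below is the conjugate of h divided by that root.
  obtain ⟨F, hF, hFn⟩ := exists_Lp_ae_eq_star_mul hU (continuous_sqrtGaussian z₀) (C := 1)
    (fun z _ => by
      rw [abs_of_pos (hpos z), sqrtGaussian, Real.exp_le_one_iff]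
      have := sq_nonneg ‖z - z₀‖
      linarith) f
  obtain ⟨h, hh, hhn⟩ := exists_inner_eq_inner_of_norm_le (toWeightedL2 U z₀)
    (toWeightedL2 U z₀ ∘ₗ
      (raisingEnd U z₀ (-Complex.I) ^ k * raisingEnd U z₀ Complex.I ^ k + a • 1))
    (C := (k.factorial : ℝ)⁻¹) (by positivity)
    (fun φ => (le_inv_mul_iff₀ (by positivity)).2
      (factorial_mul_norm_toWeightedL2_le z₀ hk a φ)) F
  obtain ⟨u, hu, hun⟩ := exists_Lp_ae_eq_star_mul hU (g := fun z => (sqrtGaussian z₀ z)⁻¹)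
    ((continuous_sqrtGaussian z₀).inv₀ fun z => (hpos z).ne') (C := Real.exp (d ^ 2 / 2))
    (fun z hz => by
      rw [abs_of_pos (inv_pos.2 (hpos z)), sqrtGaussian, ← Real.exp_neg, neg_neg]
      have := hd z hz
      gcongr) h
  have hu' (ψ : testSpace U) :
      ∫ z in U, u z * (gaussian z₀ * ψ) z = inner ℂ h (toWeightedL2 U z₀ ψ) := by
    rw [L2.inner_def]
    refine integral_congr_ae ?_
    filter_upwards [hu, coeFn_toWeightedL2 z₀ ψ] with z h1 h2
    have hne : (sqrtGaussian z₀ z : ℂ) ≠ 0 := Complex.ofReal_ne_zero.2 (hpos z).ne'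
    rw [h1, h2, Pi.mul_apply, ← sqrtGaussian_mul_self, RCLike.inner_apply, Complex.star_def,
      Complex.ofReal_inv]
    field_simp
  have hf' (ψ : testSpace U) :
      ∫ z in U, f z * (gaussian z₀ * ψ) z = inner ℂ F (toWeightedL2 U z₀ ψ) := by
    rw [L2.inner_def]
    refine integral_congr_ae ?_
    filter_upwards [hF, coeFn_toWeightedL2 z₀ ψ] with z h1 h2
    rw [h1, h2, Pi.mul_apply, ← sqrtGaussian_mul_self, RCLike.inner_apply, map_mul,
      Complex.star_def, Complex.conj_conj, Complex.conj_ofReal]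
    ring
  refine ⟨u, fun φ hφ => ?_, ?_⟩
  · obtain ⟨ψ, rfl⟩ := exists_eq_gaussian_mul z₀ hφ
    rw [dz_iterate_dzbar_iterate_gaussian_mul, hu', hu', hf', ← hh, ← inner_smul_right,
      ← inner_add_right, ← map_smul, ← map_add]
    rfl
  · calc ‖u‖ ≤ Real.exp (d ^ 2 / 2) * ‖h‖ := hun
      _ ≤ Real.exp (d ^ 2 / 2) * ((k.factorial : ℝ)⁻¹ * ‖f‖) := by
        rw [one_mul] at hFn
        gcongr
        exact hhn.trans (by gcongr)

end Wirtinger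

theorem mainTheorem12 (U : Set ℂ) (hU : IsOpen U) (hUb : Bornology.IsBounded U)
    (k : ℕ) (hk : 1 ≤ k) (α : ℝ) (hα : 1 ≤ |α|) (c : ℂ)
    (f : Lp ℂ 2 (volume.restrict U)) :
    ∃ u : Lp ℂ 2 (volume.restrict U),
      Wirtinger.IsWeakSolution U k α c f u ∧
      ‖u‖ ^ 2 ≤ Real.exp (Metric.diam U ^ 2) * |α| ^ 2 / (k.factorial : ℝ) ^ 2 * ‖f‖ ^ 2 := by
  -- Centring the weight at any point of U makes the diameter a bound for |z - z₀|.
  obtain ⟨z₀, hz₀⟩ : ∃ z₀ : ℂ, ∀ z ∈ U, ‖z - z₀‖ ≤ Metric.diam U := by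
    rcases U.eq_empty_or_nonempty with rfl | ⟨z₀, hz₀⟩
    · exact ⟨0, by simp⟩
    · exact ⟨z₀, fun z hz => by rw [← dist_eq_norm]; exact Metric.dist_le_diam_of_mem hUb hz hz₀⟩
  have hα0 : (α : ℂ) ≠ 0 := by
    rw [Complex.ofReal_ne_zero, ← abs_pos]
    linarith
  -- Dividing by α leaves the zeroth-order coefficient c/α, on which the bound does not depend.
  obtain ⟨u, hu, hun⟩ := Wirtinger.exists_weak_solution hU.measurableSet hz₀ hk (c / α) f
  refine ⟨u, fun φ hφ => ?_, ?_⟩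
  · rw [← hu φ hφ]
    field_simp
  · calc ‖u‖ ^ 2
        ≤ (Real.exp (Metric.diam U ^ 2 / 2) * ((k.factorial : ℝ)⁻¹ * ‖f‖)) ^ 2 := by gcongr
      -- The factor 1² marks the place of |α|², which enters only through 1 ≤ |α|.
      _ = Real.exp (Metric.diam U ^ 2) * 1 ^ 2 / (k.factorial : ℝ) ^ 2 * ‖f‖ ^ 2 := by
        rw [mul_pow, ← Real.exp_nat_mul, mul_pow]
        push_cast
        ring_nf
      _ ≤ _ := by gcongr
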